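/- Let $H\in(0,1)$ and let $B^H=(B^H_t)_{t\ge 0}$ be a fractional Brownian motion with Hurst parameter $H$, i.e. a zero-mean Gaussian process with (almost surely) continuous paths and covariance function $\mathbf{E}\,B^H_sB^H_t=\frac12\bigl(s^{2H}+t^{2H}-|s-t|^{2H}\bigr)$, $s,t\ge 0$. For $n\ge 1$ set $$\Delta_n^H:=\mathbf{E}\max_{0\le t\le 1}B^H_t-\mathbf{E}\max_{1\le i\le n}B^H_{i/n}.$$ Then, for every integer $n\ge 2$, both expectations are finite and $$\frac{\Delta_n^H}{n^{-H}(\ln n)^{1/2}}\ \ge\ n^{H}\left(\frac{L}{(H\ln n)^{1/2}}-1\right)^{+},$$ where $L=1/\sqrt{4\pi e\ln 2}$ and $a^+=\max(a,0)$. -/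

import Mathlib

open MeasureTheory ProbabilityTheory
open scoped NNReal

namespace FBM

/-- `B` is a fractional Brownian motion with Hurst parameter `H` under `P`: a zero-mean Gaussian
process on `[0, ∞)` with almost surely continuous paths and covariance function
`E (B s * B t) = (s ^ (2 H) + t ^ (2 H) - |s - t| ^ (2 H)) / 2`. -/
structure IsFractionalBrownianMotion {Ω : Type*} [MeasurableSpace Ω]
    (H : ℝ) (B : ℝ≥0 → Ω → ℝ) (P : Measure Ω) : Prop where
  isGaussianProcess : IsGaussianProcess B P
  mean_eq_zero : ∀ t : ℝ≥0, ∫ ω, B t ω ∂P = 0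
  covariance_eq : ∀ s t : ℝ≥0, ∫ ω, B s ω * B t ω ∂P =
    ((s : ℝ) ^ (2 * H) + (t : ℝ) ^ (2 * H) - |(s : ℝ) - (t : ℝ)| ^ (2 * H)) / 2
  continuous_paths : ∀ᵐ ω ∂P, Continuous fun t => B t ω

/-- The maximum of the path over `[0, 1]` (attained for a continuous path). -/
noncomputable def pathMax {Ω : Type*} (B : ℝ≥0 → Ω → ℝ) (ω : Ω) : ℝ :=
  ⨆ t : Set.Icc (0 : ℝ≥0) 1, B t ω

/-- The maximum of the path over the grid `i / n`, `1 ≤ i ≤ n` (for `n ≥ 1`). -/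
noncomputable def gridMax {Ω : Type*} (B : ℝ≥0 → Ω → ℝ) (n : ℕ) (ω : Ω) : ℝ :=
  ⨆ i : Set.Icc 1 n, B (((i : ℕ) : ℝ≥0) / (n : ℝ≥0)) ω

/-- The discretisation error: expected maximum over `[0, 1]` minus expected maximum over the
grid with `n` points. -/
noncomputable def approxError {Ω : Type*} [MeasurableSpace Ω]
    (B : ℝ≥0 → Ω → ℝ) (P : Measure Ω) (n : ℕ) : ℝ :=
  (∫ ω, pathMax B ω ∂P) - ∫ ω, gridMax B n ω ∂P

end FBM

/-!
Write `L = 1 / √(4 π e log 2)`. The claim is equivalent to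
`approxError B P n ≥ (L / √H - √(log n))⁺` (`FBM.le_approxError`). The error is always nonnegative,
so only the case `L / √H > √(log n)` matters, and as `n ≥ 2` this forces `H ≤ 1 / 16`. There,
two bounds that both carry an extra factor `√2` are enough.

*Upper bound for the grid.* The maximum of `n` centred Gaussians with variances at most `1` has
expectation at most `√(2 log n)`, without any independence (`integral_iSup_le_sqrt_two_log`).

*Lower bound for the path* (`FBM.le_integral_pathMax`): `E max B ≥ √2 L / √H`. On the grid `i / N`,
`0 ≤ i ≤ N`, the process has the law of `N ^ (-H) (Y i - Y 0)`, where `Y` is Gaussian with the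
stationary covariance `const - |i - j| ^ (2 H) / 2`. As a function of the distance this is convex and
decreasing, and it remains so after lowering its value at `0` by `9 / 20` since `H` is small. By
Pólya's criterion (`posSemidef_toeplitz_of_convex`) the covariance of `Y` minus `9 / 20` times the
identity is positive semidefinite, so `Y` is the sum of independent Gaussians of variance `9 / 20`
and an independent centred vector, and averaging over the latter shows that `E max Y` is at least
the expected maximum of the former (`integral_iSup_multivariateGaussian_le_add`). That one is
estimated by the probability that some of them exceed a level (`integral_iSup_pi_gaussianReal_ge`).
The choices `N ≈ exp (3 / (4 H))` and level `√(9 / (10 H))` give the constant.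

*Integrability of the path maximum.* Fernique's bound in the form
`lintegral_exp_mul_sq_norm_le_of_map_rotation_eq_self` depends only on a level below which the norm
stays with probability at least `3 / 4`. Paths are bounded, so one level serves all finite sections
of a dense sequence of times (`integrable_iSup_of_isGaussianProcess`).
-/

/-! ### Positive semidefinite Toeplitz matrices -/

/-- Pólya's decomposition on `{0, …, M}`: a sequence is a combination of a constant and of tents
`k ↦ (m - k)⁺`, whose weights are its second differences. They are nonnegative for a convex
sequence. -/
theorem eq_sum_tents (r : ℕ → ℝ) (M k : ℕ) (hk : k ≤ M) :
    r k = r M + (r M - r (M + 1)) * ((M - k : ℕ) : ℝ) +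
      ∑ m ∈ Finset.range M, (r m - 2 * r (m + 1) + r (m + 2)) * ((m + 1 - k : ℕ) : ℝ) := by
  induction M with
  | zero =>
    obtain rfl : k = 0 := by omega
    simp
  | succ M ih =>
    rw [Finset.sum_range_succ]
    rcases Nat.lt_or_ge M k with h | h
    · obtain rfl : k = M + 1 := by omega
      have : ∑ m ∈ Finset.range M, (r m - 2 * r (m + 1) + r (m + 2)) *
          ((m + 1 - (M + 1) : ℕ) : ℝ) = 0 := by
        refine Finset.sum_eq_zero fun m hm => ?_
        have : m + 1 - (M + 1) = 0 := by have := Finset.mem_range.1 hm; omega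
        simp [this]
      rw [this]
      simp
    · have h1 := ih h
      have h2 : ((M + 1 - k : ℕ) : ℝ) = ((M - k : ℕ) : ℝ) + 1 := by
        rw [Nat.succ_sub h]; push_cast; ring
      rw [h2]
      linarith

theorem posSemidef_tent (N m : ℕ) :
    (Matrix.of fun i j : Fin N =>
      ((m - ((i : ℤ) - (j : ℤ)).natAbs : ℕ) : ℝ)).PosSemidef := by
  have : (Matrix.of fun i j : Fin N => ((m - ((i : ℤ) - (j : ℤ)).natAbs : ℕ) : ℝ)) =
      Matrix.of fun i j : Fin N => volume.real
        (Set.Icc (i : ℝ) ((i : ℝ) + m) ∩ Set.Icc (j : ℝ) ((j : ℝ) + m)) := by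
    ext i j
    simp only [Matrix.of_apply, Set.Icc_inter_Icc, Real.volume_real_Icc]
    have h1 : ((m - ((i : ℤ) - (j : ℤ)).natAbs : ℕ) : ℝ) =
        (((m - ((i : ℤ) - (j : ℤ)).natAbs : ℕ) : ℤ) : ℝ) := by simp
    have h2 : ((m - ((i : ℤ) - (j : ℤ)).natAbs : ℕ) : ℤ) =
        max (min ((i : ℤ) + m) ((j : ℤ) + m) - max (i : ℤ) (j : ℤ)) 0 := by omega
    rw [h1, h2]
    push_cast
    rfl
  rw [this]
  exact posSemidef_matrix_measure_inter (fun _ => measurableSet_Icc)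
    (fun _ => isCompact_Icc.measure_ne_top)

/-- The finite form of Pólya's criterion: the Toeplitz matrix of a convex, nonincreasing and
nonnegative sequence is positive semidefinite. -/
theorem posSemidef_toeplitz_of_convex (r : ℕ → ℝ) (N : ℕ)
    (hconv : ∀ m, 2 * r (m + 1) ≤ r m + r (m + 2)) (hanti : r (N + 1) ≤ r N) (hpos : 0 ≤ r N) :
    (Matrix.of fun i j : Fin (N + 1) => r ((i : ℤ) - (j : ℤ)).natAbs).PosSemidef := by
  have hone : (Matrix.of fun _ _ : Fin (N + 1) => (1 : ℝ)).PosSemidef := by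
    have := posSemidef_matrix_measure_inter (ι := Fin (N + 1)) (μ := (volume : Measure ℝ))
      (s := fun _ => Set.Icc 0 1) (fun _ => measurableSet_Icc)
      (fun _ => isCompact_Icc.measure_ne_top)
    simpa using this
  have key : (Matrix.of fun i j : Fin (N + 1) => r ((i : ℤ) - (j : ℤ)).natAbs) =
      r N • (Matrix.of fun _ _ : Fin (N + 1) => (1 : ℝ)) +
      (r N - r (N + 1)) • (Matrix.of fun i j : Fin (N + 1) =>
        ((N - ((i : ℤ) - (j : ℤ)).natAbs : ℕ) : ℝ)) +
      ∑ m ∈ Finset.range N, (r m - 2 * r (m + 1) + r (m + 2)) •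
        (Matrix.of fun i j : Fin (N + 1) =>
          ((m + 1 - ((i : ℤ) - (j : ℤ)).natAbs : ℕ) : ℝ)) := by
    ext i j
    have hk : ((i : ℤ) - (j : ℤ)).natAbs ≤ N := by omega
    simpa [Matrix.sum_apply] using eq_sum_tents r N _ hk
  rw [key]
  refine ((hone.smul hpos).add ((posSemidef_tent _ _).smul (by linarith))).add ?_
  exact Matrix.posSemidef_sum _ fun m _ =>
    (posSemidef_tent _ _).smul (by linarith [hconv m])

/-! ### Gaussian vectors: the covariance determines the law, domination raises the maximum -/

theorem integrable_iSup_of_finite {Ω ι : Type*} [MeasurableSpace Ω] [Finite ι] {P : Measure Ω}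
    {X : ι → Ω → ℝ} (hX : ∀ i, Integrable (X i) P) :
    Integrable (fun ω => ⨆ i, X i ω) P := by
  cases nonempty_fintype ι
  refine (integrable_finsetSum Finset.univ fun i _ => (hX i).abs).mono'
    (AEMeasurable.iSup fun i => (hX i).aemeasurable).aestronglyMeasurable
    (Filter.Eventually.of_forall fun ω => ?_)
  cases isEmpty_or_nonempty ι
  · simp
  · obtain ⟨i, hi⟩ := exists_eq_ciSup_of_finite (f := fun i => X i ω)
    rw [← hi, Real.norm_eq_abs]
    exact Finset.single_le_sum (f := fun i => |X i ω|) (fun _ _ => abs_nonneg _)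
      (Finset.mem_univ i)

open Complex in
theorem multivariateGaussian_conv {ι : Type*} [Fintype ι] [DecidableEq ι] {S T : Matrix ι ι ℝ}
    (hS : S.PosSemidef) (hT : T.PosSemidef) :
    (multivariateGaussian 0 S).conv (multivariateGaussian 0 T) =
      multivariateGaussian 0 (S + T) := by
  apply Measure.ext_of_charFun
  ext x
  rw [charFun_conv, charFun_multivariateGaussian hS, charFun_multivariateGaussian hT,
    charFun_multivariateGaussian (hS.add hT), ← Complex.exp_add, Matrix.add_mulVec,
    dotProduct_add]
  simp only [inner_zero_right, ofReal_zero, zero_mul, zero_sub, ofReal_add]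
  ring_nf

theorem integrable_eval_multivariateGaussian {ι : Type*} [Fintype ι] [DecidableEq ι]
    (S : Matrix ι ι ℝ) (i : ι) :
    Integrable (fun x : EuclideanSpace ℝ ι => x i) (multivariateGaussian 0 S) :=
  (EuclideanSpace.proj (𝕜 := ℝ) i).integrable_comp IsGaussian.integrable_id

theorem integral_eval_multivariateGaussian {ι : Type*} [Fintype ι] [DecidableEq ι]
    (S : Matrix ι ι ℝ) (i : ι) :
    ∫ x : EuclideanSpace ℝ ι, x i ∂multivariateGaussian 0 S = 0 := by
  have := (EuclideanSpace.proj (𝕜 := ℝ) i).integral_comp_comm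
    (IsGaussian.integrable_id (μ := multivariateGaussian 0 S))
  simpa using this

/-- Enlarging the covariance matrix of a centred Gaussian vector in the Loewner order increases its
expected maximum: the larger vector is the smaller one plus an independent centred vector, which
can be averaged out. -/
theorem integral_iSup_multivariateGaussian_le_add {ι : Type*} [Fintype ι] [DecidableEq ι]
    [Nonempty ι] {S T : Matrix ι ι ℝ} (hS : S.PosSemidef) (hT : T.PosSemidef) :
    ∫ x : EuclideanSpace ℝ ι, ⨆ i, x i ∂multivariateGaussian 0 S ≤
      ∫ x : EuclideanSpace ℝ ι, ⨆ i, x i ∂multivariateGaussian 0 (S + T) := by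
  have hint (U : Matrix ι ι ℝ) :
      Integrable (fun x : EuclideanSpace ℝ ι => ⨆ i, x i) (multivariateGaussian 0 U) :=
    integrable_iSup_of_finite fun i => integrable_eval_multivariateGaussian U i
  have h := hint (S + T)
  rw [← multivariateGaussian_conv hS hT] at h ⊢
  rw [integral_conv h]
  have h' := (integrable_conv_iff h.aestronglyMeasurable).1 h
  refine integral_mono_ae (hint S) ?_ ?_
  · have := (integrable_map_measure (f := fun p : EuclideanSpace ℝ ι × EuclideanSpace ℝ ι =>
      p.1 + p.2) h.aestronglyMeasurable (by fun_prop)).1 h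
    exact this.integral_prod_left
  filter_upwards with x
  refine ciSup_le fun i => ?_
  have hTi := integrable_eval_multivariateGaussian T i
  calc x i = ∫ y : EuclideanSpace ℝ ι, (x i + y i) ∂multivariateGaussian 0 T := by
        rw [integral_add (integrable_const _) hTi, integral_eval_multivariateGaussian]
        simp
    _ ≤ ∫ y : EuclideanSpace ℝ ι, ⨆ i, (x + y) i ∂multivariateGaussian 0 T := by
        refine integral_mono ((integrable_const _).add hTi)
          (integrable_iSup_of_finite fun j =>
            (integrable_const (x j)).add (integrable_eval_multivariateGaussian T j)) fun y => ?_
        exact le_ciSup (f := fun i => (x + y) i) (Set.finite_range _).bddAbove i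

open Complex in
theorem multivariateGaussian_smul_one {ι : Type*} [Fintype ι] [DecidableEq ι] (c : ℝ) :
    multivariateGaussian 0 (c ^ 2 • (1 : Matrix ι ι ℝ)) =
      (Measure.pi fun _ : ι => gaussianReal 0 1).map (fun x => WithLp.toLp 2 (c • x)) := by
  have hps : (c ^ 2 • (1 : Matrix ι ι ℝ)).PosSemidef := Matrix.PosSemidef.one.smul (sq_nonneg c)
  have : (fun x : ι → ℝ => WithLp.toLp 2 (c • x)) =
      (fun y : EuclideanSpace ℝ ι => c • y) ∘ (WithLp.toLp 2) := rfl
  rw [this, ← Measure.map_map (by fun_prop) (by fun_prop), map_pi_eq_stdGaussian]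
  apply Measure.ext_of_charFun
  ext x
  rw [charFun_multivariateGaussian hps, charFun_map_smul, charFun_stdGaussian]
  have hx : x.ofLp ⬝ᵥ (c ^ 2 • (1 : Matrix ι ι ℝ)).mulVec x.ofLp = ‖c • x‖ ^ 2 := by
    rw [Matrix.smul_mulVec, Matrix.one_mulVec, dotProduct_smul, norm_smul, mul_pow,
      EuclideanSpace.real_norm_sq_eq]
    simp [dotProduct, sq]
  rw [hx]
  simp [neg_div]

/-- Two centred Gaussian vectors, possibly on different spaces, with the same covariance matrix have
the same law. -/
theorem map_eq_of_covariance_eq {Ω Ω' ι : Type*} [MeasurableSpace Ω] [MeasurableSpace Ω']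
    [Fintype ι] {P : Measure Ω} {Q : Measure Ω'} {X : ι → Ω → ℝ} {Y : ι → Ω' → ℝ}
    (hX : HasGaussianLaw (fun ω => (X · ω)) P) (hY : HasGaussianLaw (fun ω => (Y · ω)) Q)
    (hX0 : ∀ i, ∫ ω, X i ω ∂P = 0) (hY0 : ∀ i, ∫ ω, Y i ω ∂Q = 0)
    (hcov : ∀ i j, cov[X i, X j; P] = cov[Y i, Y j; Q]) :
    P.map (fun ω => (X · ω)) = Q.map (fun ω => (Y · ω)) := by
  classical
  have : IsProbabilityMeasure P := hX.isProbabilityMeasure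
  have : IsProbabilityMeasure Q := hY.isProbabilityMeasure
  have := hX.isGaussian_map
  have := hY.isGaussian_map
  apply Measure.ext_of_charFunDual
  ext L
  obtain ⟨a, hL⟩ : ∃ a : ι → ℝ, ∀ x, L x = ∑ i, a i * x i := by
    refine ⟨fun i => L (Pi.single i 1), fun x => ?_⟩
    conv_lhs => rw [← Finset.univ_sum_single x, map_sum]
    refine Finset.sum_congr rfl fun i _ => ?_
    have : Pi.single i (x i) = x i • (Pi.single i 1 : ι → ℝ) := by simp [← Pi.single_smul]
    rw [this, map_smul, smul_eq_mul, mul_comm]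
  have mX (i) : MemLp (X i) 2 P := (hX.eval i).memLp_two
  have mY (i) : MemLp (Y i) 2 Q := (hY.eval i).memLp_two
  rw [IsGaussian.charFunDual_eq, IsGaussian.charFunDual_eq, integral_complex_ofReal,
    integral_complex_ofReal,
    integral_map hX.aemeasurable (by fun_prop), integral_map hY.aemeasurable (by fun_prop),
    variance_map (by fun_prop) hX.aemeasurable, variance_map (by fun_prop) hY.aemeasurable]
  simp only [Function.comp_def, hL]
  rw [integral_finsetSum _ fun i _ => ((mX i).integrable (by simp)).const_mul _,
    integral_finsetSum _ fun i _ => ((mY i).integrable (by simp)).const_mul _,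
    ← covariance_self (Finset.aemeasurable_fun_sum _ fun i _ => (mX i).aemeasurable.const_mul _),
    ← covariance_self (Finset.aemeasurable_fun_sum _ fun i _ => (mY i).aemeasurable.const_mul _),
    covariance_fun_sum_fun_sum (fun i => (mX i).const_mul _) (fun i => (mX i).const_mul _),
    covariance_fun_sum_fun_sum (fun i => (mY i).const_mul _) (fun i => (mY i).const_mul _)]
  simp only [integral_const_mul, hX0, hY0, covariance_const_mul_left, covariance_const_mul_right,
    hcov]

/-! ### The expected maximum of independent standard Gaussians -/

/-- Lower bound for the Gaussian tail, from the part of it on `[a, a + 1 / a]`. -/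
theorem le_gaussianReal_Ici {a : ℝ} (ha : 0 < a) :
    1 / a * ((Real.sqrt (2 * Real.pi))⁻¹ * Real.exp (-(a + 1 / a) ^ 2 / 2)) ≤
      (gaussianReal 0 1).real (Set.Ici a) := by
  have hsub : (gaussianReal 0 1).real (Set.Icc a (a + 1 / a)) ≤
      (gaussianReal 0 1).real (Set.Ici a) := measureReal_mono Set.Icc_subset_Ici_self
  refine le_trans ?_ hsub
  rw [measureReal_def, gaussianReal_apply_eq_integral _ one_ne_zero, ENNReal.toReal_ofReal
    (integral_nonneg fun x => gaussianPDFReal_nonneg _ _ _)]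
  have hconst : 1 / a * ((Real.sqrt (2 * Real.pi))⁻¹ * Real.exp (-(a + 1 / a) ^ 2 / 2)) =
      ∫ _ in Set.Icc a (a + 1 / a),
        ((Real.sqrt (2 * Real.pi))⁻¹ * Real.exp (-(a + 1 / a) ^ 2 / 2)) := by
    simp [ha.le]
  rw [hconst]
  refine setIntegral_mono_on (integrableOn_const (by simp))
    (integrable_gaussianPDFReal 0 1).integrableOn measurableSet_Icc fun x hx => ?_
  simp only [gaussianPDFReal, NNReal.coe_one, mul_one, sub_zero]
  gcongr
  · linarith [hx.1]
  · exact hx.2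

/-- Among `N + 1` independent standard Gaussians, select one of the last `N` that is at least `a` if
there is any, and the first one otherwise. The first is independent of this choice, so the second
case contributes nothing on average. -/
theorem integral_iSup_pi_gaussianReal_ge (N : ℕ) (a : ℝ) :
    a * (1 - (1 - (gaussianReal 0 1).real (Set.Ici a)) ^ N) ≤
      ∫ x, ⨆ i, x i ∂(Measure.pi fun _ : Fin (N + 1) => gaussianReal 0 1) := by
  set ν := Measure.pi fun _ : Fin N => gaussianReal 0 1 with hν
  have hmp := (measurePreserving_piFinSuccAbove (fun _ : Fin (N + 1) => gaussianReal 0 1) 0).symm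
  rw [← hmp.integral_comp']
  have hint : Integrable (fun x : Fin (N + 1) → ℝ => ⨆ i, x i)
      (Measure.pi fun _ : Fin (N + 1) => gaussianReal 0 1) :=
    integrable_iSup_of_finite fun i => integrable_eval (IsGaussian.integrable_id)
  have hint' := hmp.integrable_comp_of_integrable hint
  -- the event that all coordinates but the first are below `a`
  set s : Set (Fin N → ℝ) := Set.univ.pi fun _ => Set.Iio a with hs
  have hsm : MeasurableSet s := MeasurableSet.univ_pi fun _ => measurableSet_Iio
  have hνs : ν.real s = (1 - (gaussianReal 0 1).real (Set.Ici a)) ^ N := by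
    have h1 : (gaussianReal 0 1).real (Set.Iio a) = 1 - (gaussianReal 0 1).real (Set.Ici a) := by
      rw [← probReal_compl_eq_one_sub measurableSet_Ici, Set.compl_Ici]
    rw [measureReal_def, hν, hs, Measure.pi_pi, ENNReal.toReal_prod]
    simp [← measureReal_def, h1]
  have hid : Integrable (fun x : ℝ => x) (gaussianReal 0 1) := IsGaussian.integrable_id
  have hintlow : Integrable (fun p : ℝ × (Fin N → ℝ) =>
      a * sᶜ.indicator 1 p.2 + p.1 * s.indicator 1 p.2) ((gaussianReal 0 1).prod ν) := by
    refine Integrable.add ?_ ?_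
    · exact (((integrable_const (1 : ℝ)).indicator hsm.compl).comp_snd _).const_mul a
    · exact hid.mul_prod ((integrable_const (1 : ℝ)).indicator hsm)
  calc a * (1 - (1 - (gaussianReal 0 1).real (Set.Ici a)) ^ N)
      = ∫ p : ℝ × (Fin N → ℝ), (a * sᶜ.indicator 1 p.2 + p.1 * s.indicator 1 p.2)
          ∂((gaussianReal 0 1).prod ν) := by
        rw [integral_add, integral_prod_mul (fun x : ℝ => x)
            (fun y => s.indicator (1 : (Fin N → ℝ) → ℝ) y),
          integral_const_mul, integral_fun_snd (fun y => sᶜ.indicator (1 : (Fin N → ℝ) → ℝ) y),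
          integral_id_gaussianReal, integral_indicator_one hsm.compl,
          probReal_compl_eq_one_sub hsm, hνs]
        · simp
        · exact (((integrable_const (1 : ℝ)).indicator hsm.compl).comp_snd _).const_mul a
        · exact hid.mul_prod ((integrable_const (1 : ℝ)).indicator hsm)
    _ ≤ _ := by
        refine integral_mono hintlow hint' fun p => ?_
        have hcoord (i) : (MeasurableEquiv.piFinSuccAbove (fun _ : Fin (N + 1) => ℝ) 0).symm p i ≤
            ⨆ i, (MeasurableEquiv.piFinSuccAbove (fun _ : Fin (N + 1) => ℝ) 0).symm p i :=
          le_ciSup (Set.finite_range _).bddAbove i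
        by_cases hp : p.2 ∈ s
        · simpa [hp] using hcoord 0
        · obtain ⟨i, hi⟩ : ∃ i, a ≤ p.2 i := by simpa [hs] using hp
          simpa [hp] using hi.trans (by simpa using hcoord i.succ)

/-! ### The upper bound for Gaussian maxima -/

/-- The expected maximum of `card ι` centred Gaussian variables with variances at most `1`, not
necessarily independent, is at most `√(2 log (card ι))`. -/
theorem integral_iSup_le_sqrt_two_log {Ω ι : Type*} [MeasurableSpace Ω] {P : Measure Ω}
    [Fintype ι] [Nontrivial ι] {X : ι → Ω → ℝ} (hX : ∀ i, HasGaussianLaw (X i) P)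
    (h0 : ∀ i, ∫ ω, X i ω ∂P = 0) (hvar : ∀ i, Var[X i; P] ≤ 1) :
    ∫ ω, ⨆ i, X i ω ∂P ≤ Real.sqrt (2 * Real.log (Fintype.card ι)) := by
  have : IsProbabilityMeasure P := (hX (Classical.arbitrary ι)).isProbabilityMeasure
  have hcard : (1 : ℝ) < Fintype.card ι := by exact_mod_cast Fintype.one_lt_card
  have hlog := Real.log_pos hcard
  set s := Real.sqrt (2 * Real.log (Fintype.card ι)) with hs
  have hspos : 0 < s := Real.sqrt_pos.2 (by linarith)
  have hssq : s ^ 2 = 2 * Real.log (Fintype.card ι) := Real.sq_sqrt (by linarith)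
  -- with `log (card ι) = s ^ 2 / 2`, the shift by `s ^ 2` makes the sum of these expectations
  -- at most `1`
  have hexp (i) : Integrable (fun ω => Real.exp (s * X i ω - s ^ 2)) P ∧
      ∫ ω, Real.exp (s * X i ω - s ^ 2) ∂P ≤ (Fintype.card ι : ℝ)⁻¹ := by
    have hmap := (hX i).map_eq_gaussianReal
    have hint : Integrable (fun ω => Real.exp (s * X i ω)) P := by
      have := integrable_exp_mul_gaussianReal (μ := P[X i]) (v := Var[X i; P].toNNReal) s
      rw [← hmap] at this
      exact this.comp_aemeasurable (hX i).aemeasurable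
    have hmgf := mgf_gaussianReal hmap s
    rw [mgf, h0 i, zero_mul, zero_add, Real.coe_toNNReal _ (variance_nonneg _ _)] at hmgf
    simp only [Real.exp_sub]
    refine ⟨hint.div_const _, ?_⟩
    rw [integral_div, hmgf, ← Real.exp_sub]
    calc Real.exp (Var[X i; P] * s ^ 2 / 2 - s ^ 2)
        ≤ Real.exp (-Real.log (Fintype.card ι)) := by
          gcongr
          nlinarith [hvar i, sq_nonneg s]
      _ = (Fintype.card ι : ℝ)⁻¹ := by rw [Real.exp_neg, Real.exp_log (by linarith)]
  have hsum : Integrable (fun ω => ∑ i, Real.exp (s * X i ω - s ^ 2)) P :=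
    integrable_finsetSum _ fun i _ => (hexp i).1
  calc ∫ ω, ⨆ i, X i ω ∂P
      ≤ ∫ ω, (∑ i, Real.exp (s * X i ω - s ^ 2) + (s ^ 2 - 1)) / s ∂P := by
        refine integral_mono (integrable_iSup_of_finite fun i => (hX i).integrable)
          ((hsum.add (integrable_const _)).div_const _) fun ω => ciSup_le fun i => ?_
        rw [le_div_iff₀ hspos]
        -- the tangent line of `exp` at `0`
        have h1 := Real.add_one_le_exp (s * X i ω - s ^ 2)
        have h2 := Finset.single_le_sum (f := fun i => Real.exp (s * X i ω - s ^ 2))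
          (fun _ _ => (Real.exp_pos _).le) (Finset.mem_univ i)
        linarith
    _ = (∑ i, ∫ ω, Real.exp (s * X i ω - s ^ 2) ∂P + (s ^ 2 - 1)) / s := by
        rw [integral_div, integral_add hsum (integrable_const _),
          integral_finsetSum _ fun i _ => (hexp i).1]
        simp
    _ ≤ (∑ _i : ι, (Fintype.card ι : ℝ)⁻¹ + (s ^ 2 - 1)) / s := by
        gcongr with i
        exact (hexp i).2
    _ = s := by
        have : (Fintype.card ι : ℝ) ≠ 0 := by linarith
        simp [this]
        field_simp

open scoped ENNReal

/-! ### Integrability of the supremum of a bounded Gaussian sequence -/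

/-- Fernique's bound with constants depending only on a level that the norm stays below with
probability at least `3 / 4`. -/
theorem exists_lintegral_norm_le_of_isGaussian (a : ℝ) (ha : 0 < a) :
    ∃ K : ℝ≥0∞, K ≠ ∞ ∧ ∀ (m : ℕ) (μ : Measure (Fin m → ℝ)) [IsGaussian μ], μ[id] = 0 →
      3 / 4 ≤ μ {x | ‖x‖ ≤ a} → ∫⁻ x, ‖x‖ₑ ∂μ ≤ K := by
  have hq : (3 / 4 : ℝ≥0∞) = ENNReal.ofReal (3 / 4) := by
    rw [ENNReal.ofReal_div_of_pos (by norm_num)]; simp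
  have hq2 : (1 : ℝ≥0∞) - 3 / 4 = ENNReal.ofReal (1 / 4) := by
    rw [hq, ← ENNReal.ofReal_one, ← ENNReal.ofReal_sub _ (by norm_num)]; norm_num
  have hgt : (2 : ℝ≥0∞)⁻¹ < 3 / 4 := by
    rw [hq, show (2 : ℝ≥0∞)⁻¹ = ENNReal.ofReal (2⁻¹) by
      rw [ENNReal.ofReal_inv_of_pos (by norm_num)]; simp]
    exact (ENNReal.ofReal_lt_ofReal_iff (by norm_num)).2 (by norm_num)
  have hlt : (3 / 4 : ℝ≥0∞) < 1 := by
    rw [hq, ← ENNReal.ofReal_one]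
    exact (ENNReal.ofReal_lt_ofReal_iff (by norm_num)).2 (by norm_num)
  set C := Fernique.logRatio (3 / 4) * a⁻¹ ^ 2 with hC
  have hCpos : 0 < C := mul_pos (Fernique.logRatio_pos hgt hlt) (by positivity)
  set K := ENNReal.ofReal (Real.exp (Fernique.logRatio (3 / 4))) + ∑' n : ℕ, ENNReal.ofReal
    (Real.exp (-2⁻¹ * Real.log ((3 / 4 : ℝ≥0∞) / (1 - 3 / 4)).toReal * 2 ^ n)) with hK
  have hKfin : K ≠ ∞ := by
    refine (ENNReal.add_lt_top.mpr ⟨ENNReal.ofReal_lt_top, ?_⟩).ne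
    refine Summable.tsum_ofReal_lt_top <|
      Real.summable_exp_nat_mul_of_ge ?_ (fun i => mod_cast (Nat.lt_pow_self (by simp)).le)
    refine mul_neg_of_neg_of_pos (by simp) (Real.log_pos ?_)
    rw [hq2, ENNReal.toReal_div, hq, ENNReal.toReal_ofReal (by norm_num),
      ENNReal.toReal_ofReal (by norm_num)]
    norm_num
  refine ⟨ENNReal.ofReal (1 + 1 / C) * K, ENNReal.mul_ne_top ENNReal.ofReal_ne_top hKfin, ?_⟩
  intro m μ _ h0 hμ
  have hF := lintegral_exp_mul_sq_norm_le_of_map_rotation_eq_self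
    (IsGaussian.map_rotation_eq_self h0 _) hμ hgt
  calc ∫⁻ x, ‖x‖ₑ ∂μ
      ≤ ∫⁻ x, ENNReal.ofReal (1 + 1 / C) * ENNReal.ofReal (Real.exp (C * ‖x‖ ^ 2)) ∂μ := by
        refine lintegral_mono fun x => ?_
        rw [← ofReal_norm, ← ENNReal.ofReal_mul (by positivity)]
        refine ENNReal.ofReal_le_ofReal ?_
        have h1 := Real.add_one_le_exp (C * ‖x‖ ^ 2)
        have h2 : 1 / C * (C * ‖x‖ ^ 2) = ‖x‖ ^ 2 := by field_simp
        have h3 : 1 / C * (C * ‖x‖ ^ 2 + 1) ≤ 1 / C * Real.exp (C * ‖x‖ ^ 2) := by gcongr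
        have h4 : 0 < 1 / C := by positivity
        nlinarith [sq_nonneg (‖x‖ - 1), mul_nonneg hCpos.le (sq_nonneg ‖x‖)]
    _ = ENNReal.ofReal (1 + 1 / C) * ∫⁻ x, ENNReal.ofReal (Real.exp (C * ‖x‖ ^ 2)) ∂μ :=
        lintegral_const_mul _ (by fun_prop)
    _ ≤ ENNReal.ofReal (1 + 1 / C) * K := by gcongr

/-- The supremum of an almost surely bounded centred Gaussian sequence is integrable: Fernique's
bound holds uniformly for its finite sections, and passes to the limit by monotone
convergence. -/
theorem integrable_iSup_of_isGaussianProcess {Ω : Type*} [MeasurableSpace Ω] {P : Measure Ω}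
    {X : ℕ → Ω → ℝ} (hX : IsGaussianProcess X P) (h0 : ∀ k, ∫ ω, X k ω ∂P = 0)
    (hbdd : ∀ᵐ ω ∂P, ∃ M : ℝ, ∀ k, |X k ω| ≤ M) :
    Integrable (fun ω => ⨆ k, X k ω) P := by
  have : IsProbabilityMeasure P := hX.isProbabilityMeasure
  obtain ⟨a, ha, haP⟩ : ∃ a : ℝ, 0 < a ∧ 3 / 4 ≤ P {ω | ∀ k, |X k ω| ≤ a} := by
    have hmono : Monotone fun n : ℕ => {ω | ∀ k, |X k ω| ≤ n} := fun m n hmn ω hω k =>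
      (hω k).trans (by exact_mod_cast hmn)
    have hlim := tendsto_measure_iUnion_atTop (μ := P) hmono
    have hone : P (⋃ n : ℕ, {ω | ∀ k, |X k ω| ≤ n}) = 1 := by
      rw [← measure_univ (μ := P)]
      refine measure_congr ?_
      filter_upwards [hbdd] with ω ⟨M, hM⟩
      refine propext (iff_of_true ?_ trivial)
      obtain ⟨n, hn⟩ := exists_nat_ge M
      exact Set.mem_iUnion.2 ⟨n, fun k => (hM k).trans hn⟩
    rw [hone] at hlim
    have hlt : (3 / 4 : ℝ≥0∞) < 1 := by
      rw [ENNReal.div_lt_iff (by simp) (by simp)]; norm_num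
    obtain ⟨n, hn, hn1⟩ :=
      ((hlim.eventually (lt_mem_nhds hlt)).and (Filter.eventually_ge_atTop 1)).exists
    exact ⟨n, by exact_mod_cast hn1, hn.le⟩
  obtain ⟨K, hK, hbound⟩ := exists_lintegral_norm_le_of_isGaussian a ha
  have hlaw (m : ℕ) : HasGaussianLaw (fun ω => fun i : Fin m => X i ω) P := by
    let L : (Finset.range m → ℝ) →L[ℝ] (Fin m → ℝ) :=
      ContinuousLinearMap.pi fun i => ContinuousLinearMap.proj ⟨i, Finset.mem_range.2 i.2⟩
    exact (hX.hasGaussianLaw (Finset.range m)).map L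
  have hsec (m : ℕ) : ∫⁻ ω, ‖fun i : Fin m => X i ω‖ₑ ∂P ≤ K := by
    have := (hlaw m).isGaussian_map
    have hae := (hlaw m).aemeasurable
    have h := hbound m (P.map fun ω => fun i : Fin m => X i ω) ?_ ?_
    · rwa [lintegral_map' (by fun_prop) hae] at h
    · rw [integral_map hae (by fun_prop)]
      ext i
      have := (ContinuousLinearMap.proj (R := ℝ) (φ := fun _ : Fin m => ℝ) i).integral_comp_comm
        ((hlaw m).integrable)
      simpa [h0] using this.symm
    · rw [Measure.map_apply_of_aemeasurable hae (measurableSet_le (by fun_prop) (by fun_prop))]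
      refine haP.trans (measure_mono fun ω hω => ?_)
      exact (pi_norm_le_iff_of_nonneg ha.le).2 fun i => hω i
  have hmeas : AEMeasurable (fun ω => ⨆ k, X k ω) P := AEMeasurable.iSup fun k => hX.aemeasurable k
  refine ⟨hmeas.aestronglyMeasurable, ?_⟩
  refine lt_of_le_of_lt ?_ hK.lt_top
  have hmono (ω : Ω) : Monotone fun m : ℕ => ‖fun i : Fin m => X i ω‖ₑ := fun m n hmn => by
    simp only [← ofReal_norm]
    exact ENNReal.ofReal_le_ofReal <| (pi_norm_le_iff_of_nonneg (norm_nonneg _)).2 fun i =>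
      norm_le_pi_norm (fun i : Fin n => X i ω) (Fin.castLE hmn i)
  calc ∫⁻ ω, ‖⨆ k, X k ω‖ₑ ∂P ≤ ∫⁻ ω, ⨆ m : ℕ, ‖fun i : Fin m => X i ω‖ₑ ∂P := by
        refine lintegral_mono fun ω => ?_
        have hcoord (k : ℕ) : ‖X k ω‖ₑ ≤ ⨆ m : ℕ, ‖fun i : Fin m => X i ω‖ₑ := by
          refine le_trans ?_ (le_iSup _ (k + 1))
          simp only [← ofReal_norm]
          exact ENNReal.ofReal_le_ofReal
            (norm_le_pi_norm (fun i : Fin (k + 1) => X i ω) (Fin.last k))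
        by_cases htop : ⨆ m : ℕ, ‖fun i : Fin m => X i ω‖ₑ = ∞
        · simp [htop]
        have hreal (k : ℕ) : |X k ω| ≤ (⨆ m : ℕ, ‖fun i : Fin m => X i ω‖ₑ).toReal := by
          rw [← Real.norm_eq_abs, ← toReal_enorm]
          exact ENNReal.toReal_mono htop (hcoord k)
        rw [← ofReal_norm, Real.norm_eq_abs]
        refine ENNReal.ofReal_le_of_le_toReal (abs_le.2 ⟨?_, ?_⟩)
        · refine (neg_le_of_abs_le (hreal 0)).trans (le_ciSup (f := fun k => X k ω) ?_ 0)
          exact ⟨_, by rintro _ ⟨k, rfl⟩; exact (le_abs_self _).trans (hreal k)⟩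
        · exact ciSup_le fun k => (le_abs_self _).trans (hreal k)
    _ = ⨆ m : ℕ, ∫⁻ ω, ‖fun i : Fin m => X i ω‖ₑ ∂P :=
        lintegral_iSup' (fun m => (hlaw m).aemeasurable.enorm)
          (Filter.Eventually.of_forall hmono)
    _ ≤ K := iSup_le hsec

/-! ### Fractional Brownian motion on a grid -/

namespace FBM

theorem cov_eq {Ω : Type*} [MeasurableSpace Ω] {H : ℝ} {B : ℝ≥0 → Ω → ℝ} {P : Measure Ω}
    (hB : IsFractionalBrownianMotion H B P) (s t : ℝ≥0) :
    cov[B s, B t; P] =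
      ((s : ℝ) ^ (2 * H) + (t : ℝ) ^ (2 * H) - |(s : ℝ) - (t : ℝ)| ^ (2 * H)) / 2 := by
  have := hB.isGaussianProcess.isProbabilityMeasure
  rw [covariance_eq_sub (hB.isGaussianProcess.hasGaussianLaw_eval s).memLp_two
    (hB.isGaussianProcess.hasGaussianLaw_eval t).memLp_two, hB.mean_eq_zero, zero_mul, sub_zero,
    ← hB.covariance_eq]
  rfl

/-- Covariance matrix of a stationary Gaussian vector `Y` on `{0, …, N}` for which `Y i - Y 0` has
the law of the fractional Brownian motion at time `i`, for `i ≤ N`. The variance `N ^ (2 H) / 2` is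
the least constant that keeps all entries nonnegative; the matrix is positive semidefinite at least
for `H ≤ 1 / 16`, which is all that is needed. -/
noncomputable def stationaryCov (H : ℝ) (N : ℕ) : Matrix (Fin (N + 1)) (Fin (N + 1)) ℝ :=
  Matrix.of fun i j => (N : ℝ) ^ (2 * H) / 2 - |(i : ℝ) - (j : ℝ)| ^ (2 * H) / 2

theorem two_rpow_le {H : ℝ} (hH : H ≤ 1 / 16) : (2 : ℝ) ^ (2 * H) ≤ 11 / 10 := by
  calc (2 : ℝ) ^ (2 * H) ≤ ((11 / 10 : ℝ) ^ (8 : ℕ)) ^ (1 / 8 : ℝ) := by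
        refine (Real.rpow_le_rpow_of_exponent_le (by norm_num)
          (show 2 * H ≤ 1 / 8 by linarith)).trans ?_
        gcongr
        norm_num
    _ = 11 / 10 := by
        rw [← Real.rpow_natCast, ← Real.rpow_mul (by norm_num)]
        norm_num

/-- For small `H` the stationary covariance dominates `9 / 20` times the identity: off the diagonal
it is convex in the distance, and it stays convex after the diagonal is lowered by `9 / 20`,
because `2 ^ (2 H) ≤ 11 / 10`. -/
theorem exists_stationaryCov_eq_add {H : ℝ} (hH0 : 0 < H) (hH : H ≤ 1 / 16) {N : ℕ}
    (hN : N ≠ 0) : ∃ T : Matrix (Fin (N + 1)) (Fin (N + 1)) ℝ, T.PosSemidef ∧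
      stationaryCov H N =
        Real.sqrt (9 / 20) ^ 2 • (1 : Matrix (Fin (N + 1)) (Fin (N + 1)) ℝ) + T := by
  set r : ℕ → ℝ := fun k =>
    (N : ℝ) ^ (2 * H) / 2 - (if k = 0 then 9 / 20 else (k : ℝ) ^ (2 * H) / 2) with hr
  refine ⟨Matrix.of fun i j : Fin (N + 1) => r ((i : ℤ) - (j : ℤ)).natAbs,
    posSemidef_toeplitz_of_convex r N ?_ ?_ ?_, ?_⟩
  · rintro (_ | m)
    · have := two_rpow_le hH
      simp only [hr]
      norm_num
      linarith
    · have hconc := Real.concaveOn_rpow (p := 2 * H) (by linarith) (by linarith)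
      have hc := hconc.2 (show (m : ℝ) + 1 ∈ Set.Ici 0 from Set.mem_Ici.2 (by positivity))
        (show (m : ℝ) + 3 ∈ Set.Ici 0 from Set.mem_Ici.2 (by positivity))
        (show (0 : ℝ) ≤ 1 / 2 by norm_num) (show (0 : ℝ) ≤ 1 / 2 by norm_num) (by norm_num)
      simp only [smul_eq_mul] at hc
      have h2 : 1 / 2 * ((m : ℝ) + 1) + 1 / 2 * (m + 3) = m + 2 := by ring
      rw [h2] at hc
      simp only [hr]
      push_cast
      have e1 : (m : ℝ) + 1 + 1 = m + 2 := by ring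
      have e2 : (m : ℝ) + 1 + 2 = m + 3 := by ring
      simp only [e1, e2]
      linarith
  · simp only [hr, Nat.succ_ne_zero, if_false, hN]
    have : (N : ℝ) ^ (2 * H) ≤ ((N + 1 : ℕ) : ℝ) ^ (2 * H) := by
      gcongr
      linarith
    linarith
  · simp [hr, hN]
  · ext i j
    have hcast : ((((i : ℤ) - (j : ℤ)).natAbs : ℕ) : ℝ) = |(i : ℝ) - (j : ℝ)| := by
      rw [Nat.cast_natAbs]; push_cast; rfl
    rw [Real.sq_sqrt (by norm_num)]
    simp only [stationaryCov, Matrix.of_apply, Matrix.add_apply, Matrix.smul_apply, hr, hcast,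
      Matrix.one_apply]
    by_cases hij : i = j
    · subst hij
      have : (0 : ℝ) ^ (2 * H) = 0 := Real.zero_rpow (by positivity)
      simp [this]
    · have : ((i : ℤ) - (j : ℤ)).natAbs ≠ 0 := by omega
      simp [this, hij]

theorem posSemidef_stationaryCov {H : ℝ} (hH0 : 0 < H) (hH : H ≤ 1 / 16) {N : ℕ} (hN : N ≠ 0) :
    (stationaryCov H N).PosSemidef := by
  obtain ⟨T, hT, h⟩ := exists_stationaryCov_eq_add hH0 hH hN
  rw [h]
  exact (Matrix.PosSemidef.one.smul (sq_nonneg _)).add hT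

/-- By self-similarity and stationarity of increments, the grid values have the law of
`N ^ (-H) (Y i - Y 0)`; the common term `Y 0` is centred and drops out of the expected maximum. -/
theorem integral_iSup_grid_eq {Ω : Type*} [MeasurableSpace Ω] {H : ℝ} {B : ℝ≥0 → Ω → ℝ}
    {P : Measure Ω} (hB : IsFractionalBrownianMotion H B P) (hH0 : 0 < H) (hH : H ≤ 1 / 16)
    {N : ℕ} (hN : N ≠ 0) :
    ∫ ω, ⨆ i : Fin (N + 1), B ((i : ℕ) / N) ω ∂P =
      (N : ℝ) ^ (-H) * ∫ y : EuclideanSpace ℝ (Fin (N + 1)), ⨆ i, y i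
        ∂multivariateGaussian 0 (stationaryCov H N) := by
  set S := stationaryCov H N with hS
  set μ := multivariateGaussian 0 S with hμ
  have hSps : S.PosSemidef := posSemidef_stationaryCov hH0 hH hN
  set h := (N : ℝ) ^ (-H) with hh
  have hNpos : (0 : ℝ) < N := by positivity
  have hh0 : 0 ≤ h := by positivity
  have hsq : h * h = ((N : ℝ) ^ (2 * H))⁻¹ := by
    rw [hh, ← Real.rpow_add hNpos, ← Real.rpow_neg hNpos.le]; ring_nf
  let Y : Fin (N + 1) → EuclideanSpace ℝ (Fin (N + 1)) → ℝ := fun i y => h * (y i - y 0)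
  have hint (i) := integrable_eval_multivariateGaussian S i
  have hid : HasGaussianLaw (id : EuclideanSpace ℝ (Fin (N + 1)) → _) μ :=
    IsGaussian.hasGaussianLaw_id
  have hmem (i) : MemLp (fun y : EuclideanSpace ℝ (Fin (N + 1)) => y i) 2 μ :=
    (hid.map (EuclideanSpace.proj (𝕜 := ℝ) i)).memLp_two
  have hXlaw : HasGaussianLaw (fun ω => fun i : Fin (N + 1) => B ((i : ℕ) / N) ω) P := by
    classical
    let I : Finset ℝ≥0 := Finset.univ.image fun i : Fin (N + 1) => ((i : ℕ) : ℝ≥0) / N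
    let L : (I → ℝ) →L[ℝ] (Fin (N + 1) → ℝ) :=
      ContinuousLinearMap.pi fun i => ContinuousLinearMap.proj
        ⟨((i : ℕ) : ℝ≥0) / N, Finset.mem_image_of_mem _ (Finset.mem_univ i)⟩
    exact (hB.isGaussianProcess.hasGaussianLaw I).map L
  have hYlaw : HasGaussianLaw (fun y => (Y · y)) μ := by
    let L : EuclideanSpace ℝ (Fin (N + 1)) →L[ℝ] (Fin (N + 1) → ℝ) :=
      ContinuousLinearMap.pi fun i =>
        h • (EuclideanSpace.proj (𝕜 := ℝ) i - EuclideanSpace.proj (𝕜 := ℝ) 0)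
    exact hid.map L
  have hY0 (i) : ∫ y, Y i y ∂μ = 0 := by
    simp only [Y]
    rw [integral_const_mul, integral_sub (hint i) (hint 0), integral_eval_multivariateGaussian,
      integral_eval_multivariateGaussian]
    simp
  have hcov (i j : Fin (N + 1)) :
      cov[B ((i : ℕ) / N), B ((j : ℕ) / N); P] = cov[Y i, Y j; μ] := by
    simp only [Y]
    rw [cov_eq hB, covariance_const_mul_left, covariance_const_mul_right,
      covariance_fun_sub_fun_sub (hmem i) (hmem 0) (hmem j) (hmem 0),
      covariance_eval_multivariateGaussian hSps, covariance_eval_multivariateGaussian hSps,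
      covariance_eval_multivariateGaussian hSps, covariance_eval_multivariateGaussian hSps,
      ← mul_assoc, hsq]
    have h0 : (0 : ℝ) ^ (2 * H) = 0 := Real.zero_rpow (by positivity)
    have hd : |(i : ℝ) / N - (j : ℝ) / N| = |(i : ℝ) - j| / N := by
      rw [← sub_div, abs_div, abs_of_pos hNpos]
    have hpos : (0 : ℝ) < (N : ℝ) ^ (2 * H) := by positivity
    simp only [hS, stationaryCov, Matrix.of_apply, NNReal.coe_div, NNReal.coe_natCast, hd,
      Fin.val_zero, Nat.cast_zero, sub_zero, zero_sub, abs_neg, Nat.abs_cast, sub_self, abs_zero,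
      h0]
    rw [Real.div_rpow (by positivity) hNpos.le, Real.div_rpow (by positivity) hNpos.le,
      Real.div_rpow (abs_nonneg _) hNpos.le]
    field_simp
    ring
  have hmap := map_eq_of_covariance_eq hXlaw hYlaw (fun _ => hB.mean_eq_zero _) hY0 hcov
  have hmeas : Measurable fun x : Fin (N + 1) → ℝ => ⨆ i, x i :=
    Measurable.iSup fun i => measurable_pi_apply i
  calc ∫ ω, ⨆ i : Fin (N + 1), B ((i : ℕ) / N) ω ∂P
      = ∫ x, ⨆ i, x i ∂P.map (fun ω => fun i : Fin (N + 1) => B ((i : ℕ) / N) ω) :=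
        (integral_map hXlaw.aemeasurable hmeas.aestronglyMeasurable).symm
    _ = ∫ y, ⨆ i, Y i y ∂μ := by
        rw [hmap, integral_map hYlaw.aemeasurable hmeas.aestronglyMeasurable]
    _ = ∫ y : EuclideanSpace ℝ (Fin (N + 1)), h * ((⨆ i, y i) - y 0) ∂μ := by
        congr with y
        simp only [Y]
        rw [← Real.mul_iSup_of_nonneg hh0, ciSup_sub (Set.finite_range _).bddAbove]
    _ = h * ∫ y : EuclideanSpace ℝ (Fin (N + 1)), ⨆ i, y i ∂μ := by
        rw [integral_const_mul, integral_sub (integrable_iSup_of_finite hint) (hint 0),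
          integral_eval_multivariateGaussian, sub_zero]

/-- The grid maximum is bounded below through independent Gaussians of variance `9 / 20`, all but
one of which are compared with the level `a`. -/
theorem le_integral_iSup_grid {Ω : Type*} [MeasurableSpace Ω] {H : ℝ} {B : ℝ≥0 → Ω → ℝ}
    {P : Measure Ω} (hB : IsFractionalBrownianMotion H B P) (hH0 : 0 < H) (hH : H ≤ 1 / 16)
    {N : ℕ} (hN : N ≠ 0) (a : ℝ) :
    (N : ℝ) ^ (-H) * (Real.sqrt (9 / 20) *
      (a * (1 - (1 - (gaussianReal 0 1).real (Set.Ici a)) ^ N))) ≤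
      ∫ ω, ⨆ i : Fin (N + 1), B ((i : ℕ) / N) ω ∂P := by
  rw [integral_iSup_grid_eq hB hH0 hH hN]
  gcongr
  obtain ⟨T, hT, h⟩ := exists_stationaryCov_eq_add hH0 hH hN
  rw [h]
  refine le_trans ?_ (integral_iSup_multivariateGaussian_le_add
    (Matrix.PosSemidef.one.smul (sq_nonneg _)) hT)
  rw [multivariateGaussian_smul_one, integral_map (by fun_prop)
    (Measurable.iSup fun i => by fun_prop).aestronglyMeasurable]
  simp only [Pi.smul_apply, smul_eq_mul]
  simp_rw [← Real.mul_iSup_of_nonneg (Real.sqrt_nonneg (9 / 20))]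
  rw [integral_const_mul]
  gcongr
  exact integral_iSup_pi_gaussianReal_ge N a

/-! ### The two maxima -/

theorem bddAbove_range_path {f : ℝ≥0 → ℝ} (hf : Continuous f) :
    BddAbove (Set.range fun t : Set.Icc (0 : ℝ≥0) 1 => f t) :=
  (isCompact_range (hf.comp continuous_subtype_val)).bddAbove

theorem integrable_pathMax {Ω : Type*} [MeasurableSpace Ω] {H : ℝ} {B : ℝ≥0 → Ω → ℝ}
    {P : Measure Ω} (hB : IsFractionalBrownianMotion H B P) : Integrable (pathMax B) P := by
  have : Nonempty (Set.Icc (0 : ℝ≥0) 1) := ⟨⟨0, by simp⟩⟩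
  let q := TopologicalSpace.denseSeq (Set.Icc (0 : ℝ≥0) 1)
  have hq : DenseRange q := TopologicalSpace.denseRange_denseSeq _
  refine (integrable_iSup_of_isGaussianProcess (X := fun k => B (q k))
    (hB.isGaussianProcess.comp_right fun k => (q k : ℝ≥0)) (fun _ => hB.mean_eq_zero _) ?_).congr ?_
  · filter_upwards [hB.continuous_paths] with ω hω
    obtain ⟨M, hM⟩ := bddAbove_range_path hω.abs
    exact ⟨M, fun k => hM ⟨q k, rfl⟩⟩
  · filter_upwards [hB.continuous_paths] with ω hω
    have hb := bddAbove_range_path hω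
    have hbq : BddAbove (Set.range fun k => B (q k) ω) :=
      hb.mono (by rintro _ ⟨k, rfl⟩; exact ⟨q k, rfl⟩)
    refine le_antisymm (ciSup_le fun k => le_ciSup hb (q k)) (ciSup_le fun t => ?_)
    refine hq.induction_on (p := fun t : Set.Icc (0 : ℝ≥0) 1 => B t ω ≤ ⨆ k, B (q k) ω) t
      (isClosed_le (hω.comp continuous_subtype_val) continuous_const) fun k => le_ciSup hbq k

theorem integrable_gridMax {Ω : Type*} [MeasurableSpace Ω] {H : ℝ} {B : ℝ≥0 → Ω → ℝ}
    {P : Measure Ω} (hB : IsFractionalBrownianMotion H B P) (n : ℕ) :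
    Integrable (gridMax B n) P :=
  integrable_iSup_of_finite fun _ => (hB.isGaussianProcess.hasGaussianLaw_eval _).integrable

theorem div_mem_Icc {i n : ℕ} (h : i ≤ n) : (i : ℝ≥0) / n ∈ Set.Icc (0 : ℝ≥0) 1 :=
  ⟨zero_le, div_le_one_of_le₀ (by exact_mod_cast h) (zero_le)⟩

theorem gridMax_le_pathMax {Ω : Type*} [MeasurableSpace Ω] {H : ℝ} {B : ℝ≥0 → Ω → ℝ}
    {P : Measure Ω} (hB : IsFractionalBrownianMotion H B P) {n : ℕ} (hn : 1 ≤ n) :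
    gridMax B n ≤ᵐ[P] pathMax B := by
  have : Nonempty (Set.Icc 1 n) := ⟨⟨1, by simp [hn]⟩⟩
  filter_upwards [hB.continuous_paths] with ω hω
  exact ciSup_le fun i => le_ciSup (bddAbove_range_path hω) ⟨_, div_mem_Icc i.2.2⟩

theorem integral_iSup_grid_le_integral_pathMax {Ω : Type*} [MeasurableSpace Ω] {H : ℝ}
    {B : ℝ≥0 → Ω → ℝ} {P : Measure Ω} (hB : IsFractionalBrownianMotion H B P) (N : ℕ) :
    ∫ ω, ⨆ i : Fin (N + 1), B ((i : ℕ) / N) ω ∂P ≤ ∫ ω, pathMax B ω ∂P := by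
  refine integral_mono_ae (integrable_iSup_of_finite fun _ =>
    (hB.isGaussianProcess.hasGaussianLaw_eval _).integrable) (integrable_pathMax hB) ?_
  filter_upwards [hB.continuous_paths] with ω hω
  exact ciSup_le fun i => le_ciSup (bddAbove_range_path hω) ⟨_, div_mem_Icc (by omega)⟩

theorem integral_gridMax_le {Ω : Type*} [MeasurableSpace Ω] {H : ℝ} {B : ℝ≥0 → Ω → ℝ}
    {P : Measure Ω} (hB : IsFractionalBrownianMotion H B P) (hH : 0 < H) {n : ℕ} (hn : 2 ≤ n) :
    ∫ ω, gridMax B n ω ∂P ≤ Real.sqrt (2 * Real.log n) := by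
  have : Nontrivial (Set.Icc 1 n) :=
    ⟨⟨1, by simp; omega⟩, ⟨2, by simp; omega⟩, by simp [Subtype.ext_iff]⟩
  have hcard : Fintype.card (Set.Icc 1 n) = n := by simp
  have h := integral_iSup_le_sqrt_two_log (P := P)
    (X := fun i : Set.Icc 1 n => B (((i : ℕ) : ℝ≥0) / n))
    (fun _ => hB.isGaussianProcess.hasGaussianLaw_eval _) (fun _ => hB.mean_eq_zero _) fun i => ?_
  · rwa [hcard] at h
  · rw [← covariance_self (hB.isGaussianProcess.aemeasurable _), cov_eq hB, sub_self, abs_zero,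
      Real.zero_rpow (by positivity)]
    have h1 : (((((i : ℕ) : ℝ≥0) / n : ℝ≥0)) : ℝ) ^ (2 * H) ≤ 1 :=
      Real.rpow_le_one (NNReal.coe_nonneg _) (by exact_mod_cast (div_mem_Icc i.2.2).2)
        (by positivity)
    linarith

/-! ### The choice of the grid and of the level -/

/-- With `N = ⌊exp (3 / (4 H))⌋` and `a² = 9 / (10 H)`, on average at least `4` of `N` independent
standard Gaussians exceed `a`, and `N ^ (-H) ≥ exp (-3 / 4)`. -/
theorem exists_grid_and_level {H : ℝ} (hH0 : 0 < H) (hH : H ≤ 1 / 16) :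
    ∃ N : ℕ, N ≠ 0 ∧ Real.exp (-(3 / 4)) ≤ (N : ℝ) ^ (-H) ∧
      4 ≤ (gaussianReal 0 1).real (Set.Ici (Real.sqrt (9 / 10) / Real.sqrt H)) * N := by
  -- `u = 1 / (16 H)` is at least `1`; below, `N ≈ exp (12 u)` and `a ^ 2 = 72 / 5 * u`
  obtain ⟨u, hu⟩ : ∃ u, u = 1 / (16 * H) := ⟨_, rfl⟩
  have hu1 : 1 ≤ u := by rw [hu, le_div_iff₀ (by positivity)]; linarith
  have hHu : H * u = 1 / 16 := by rw [hu]; field_simp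
  set a := Real.sqrt (9 / 10) / Real.sqrt H with ha
  have hapos : 0 < a := by positivity
  have ha2 : a ^ 2 = 72 / 5 * u := by
    rw [ha, div_pow, Real.sq_sqrt (by norm_num), Real.sq_sqrt hH0.le, hu]
    field_simp
    norm_num
  set N := ⌊Real.exp (12 * u)⌋₊ with hN
  have hbig : (1000 : ℝ) ≤ Real.exp (12 * u) := by
    calc (1000 : ℝ) ≤ Real.exp 1 ^ 12 :=
          (by norm_num : (1000 : ℝ) ≤ 2 ^ 12).trans
            (by gcongr; linarith [Real.exp_one_gt_d9])
      _ = Real.exp 12 := by rw [← Real.exp_nat_mul]; norm_num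
      _ ≤ _ := by gcongr; linarith
  have hNle : (N : ℝ) ≤ Real.exp (12 * u) := Nat.floor_le (Real.exp_pos _).le
  have hNge : 999 / 1000 * Real.exp (12 * u) ≤ N := by
    have := Nat.lt_floor_add_one (Real.exp (12 * u))
    rw [← hN] at this
    linarith
  have hNpos : (0 : ℝ) < N := by linarith
  refine ⟨N, by exact_mod_cast hNpos.ne', ?_, ?_⟩
  · calc Real.exp (-(3 / 4)) = Real.exp (12 * u) ^ (-H) := by
          rw [← Real.exp_mul]
          congr 1
          linear_combination 12 * hHu
      _ ≤ (N : ℝ) ^ (-H) := Real.rpow_le_rpow_of_nonpos hNpos hNle (by linarith)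
  -- the exponent in the lower bound for the tail
  have hexp : -(36 / 5 * u + 207 / 200) ≤ -(a + 1 / a) ^ 2 / 2 := by
    have h1 : (a + 1 / a) ^ 2 = a ^ 2 + 2 + 1 / a ^ 2 := by field_simp; ring
    have h2 : 1 / a ^ 2 ≤ 5 / 72 := by
      rw [ha2, div_le_div_iff₀ (by positivity) (by norm_num)]
      linarith
    rw [h1]
    linarith
  have hden : a * Real.sqrt (2 * Real.pi) ≤ 952 / 100 * ((1 + u) / 2) := by
    refine abs_le_of_sq_le_sq' ?_ (by positivity) |>.2
    rw [mul_pow, Real.sq_sqrt (by positivity), ha2]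
    have := Real.pi_lt_d4
    nlinarith [sq_nonneg (u - 1)]
  have hE : (42 : ℝ) * (1 + 24 / 5 * (u - 1)) ≤ Real.exp (24 / 5 * u - 207 / 200) := by
    have h1 : (42 : ℝ) ≤ Real.exp (15 / 4) := by
      refine (pow_le_pow_iff_left₀ (by norm_num) (Real.exp_pos _).le (n := 4) (by norm_num)).1 ?_
      calc (42 : ℝ) ^ 4 ≤ 2.718 ^ 15 := by norm_num
        _ ≤ Real.exp 1 ^ 15 := by gcongr; linarith [Real.exp_one_gt_d9]
        _ = Real.exp (15 / 4) ^ 4 := by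
            rw [← Real.exp_nat_mul, ← Real.exp_nat_mul]; norm_num
    calc (42 : ℝ) * (1 + 24 / 5 * (u - 1))
        ≤ Real.exp (15 / 4) * Real.exp (24 / 5 * (u - 1)) := by
          gcongr
          linarith [Real.add_one_le_exp (24 / 5 * (u - 1))]
      _ ≤ Real.exp (24 / 5 * u - 207 / 200) := by
          rw [← Real.exp_add]
          gcongr
          linarith
  have hs : 0 < Real.sqrt (2 * Real.pi) := by positivity
  calc (4 : ℝ) ≤ (a * Real.sqrt (2 * Real.pi))⁻¹ *
        (999 / 1000 * Real.exp (24 / 5 * u - 207 / 200)) := by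
        rw [inv_mul_eq_div, le_div_iff₀ (by positivity)]
        linarith
    _ = 1 / a * ((Real.sqrt (2 * Real.pi))⁻¹ * Real.exp (-(36 / 5 * u + 207 / 200))) *
          (999 / 1000 * Real.exp (12 * u)) := by
        rw [show 24 / 5 * u - 207 / 200 = -(36 / 5 * u + 207 / 200) + 12 * u by ring, Real.exp_add]
        field_simp
    _ ≤ (gaussianReal 0 1).real (Set.Ici a) * N := by
        gcongr
        refine le_trans ?_ (le_gaussianReal_Ici hapos)
        gcongr

/-- The numerical comparison of constants behind `exists_grid_and_level`; the factor `49 / 50` is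
a lower bound for the probability that some of the Gaussians exceed the level. -/
theorem sqrt_two_mul_const_le :
    Real.sqrt 2 * (1 / Real.sqrt (4 * Real.pi * Real.exp 1 * Real.log 2)) ≤
      Real.exp (-(3 / 4)) * (Real.sqrt (9 / 20) * (Real.sqrt (9 / 10) * (49 / 50))) := by
  have hlog := Real.log_two_gt_d9
  have hpi := Real.pi_gt_d4
  have hlogpos : 0 < Real.log 2 := by linarith
  refine abs_le_of_sq_le_sq' ?_ (by positivity) |>.2
  rw [mul_pow, mul_pow, mul_pow, mul_pow, div_pow, Real.sq_sqrt (by norm_num),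
    Real.sq_sqrt (by positivity), Real.sq_sqrt (by norm_num), Real.sq_sqrt (by norm_num)]
  have hhalf : Real.exp (1 / 2) ≤ 33 / 20 := by
    refine (pow_le_pow_iff_left₀ (Real.exp_pos _).le (by norm_num) (n := 2) (by norm_num)).1 ?_
    rw [← Real.exp_nat_mul]
    norm_num
    linarith [Real.exp_one_lt_d9]
  have h1 : Real.exp (-(3 / 4)) ^ 2 * Real.exp 1 * Real.exp (1 / 2) = 1 := by
    rw [← Real.exp_nat_mul, ← Real.exp_add, ← Real.exp_add, Real.exp_eq_one_iff]
    norm_num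
  have h2 : 20 / 33 ≤ Real.exp (-(3 / 4)) ^ 2 * Real.exp 1 := by
    have : 0 < Real.exp (-(3 / 4)) ^ 2 * Real.exp 1 := by positivity
    nlinarith
  have h3 : (4.35 : ℝ) ≤ 2 * Real.pi * Real.log 2 := by nlinarith
  rw [one_pow, mul_one_div, div_le_iff₀ (by positivity)]
  calc (2 : ℝ) ≤ 2 * (9 / 20 * (9 / 10 * (49 / 50) ^ 2)) * (20 / 33) * 4.35 := by norm_num
    _ ≤ 2 * (9 / 20 * (9 / 10 * (49 / 50) ^ 2)) * (Real.exp (-(3 / 4)) ^ 2 * Real.exp 1) *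
        (2 * Real.pi * Real.log 2) := by gcongr
    _ = _ := by ring

/-- A nontrivial lower bound for some `n ≥ 2` forces `H` to be small. -/
theorem le_one_div_sixteen {H : ℝ} (hH : 0 < H) {n : ℕ} (hn : 2 ≤ n)
    (h : Real.sqrt (Real.log n) <
      1 / Real.sqrt (4 * Real.pi * Real.exp 1 * Real.log 2) / Real.sqrt H) : H ≤ 1 / 16 := by
  have hlog := Real.log_two_gt_d9
  have hlogpos : 0 < Real.log 2 := by linarith
  have hmono : Real.log 2 ≤ Real.log n := Real.log_le_log (by norm_num) (by exact_mod_cast hn)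
  have h' := pow_lt_pow_left₀ h (Real.sqrt_nonneg _) (n := 2) (by norm_num)
  rw [Real.sq_sqrt (by linarith), div_pow, div_pow, Real.sq_sqrt (by positivity),
    Real.sq_sqrt hH.le, one_pow, div_div, lt_div_iff₀ (by positivity)] at h'
  have hpi := Real.pi_gt_d4
  have he := Real.exp_one_gt_d9
  have h3 : (34 : ℝ) ≤ 4 * Real.pi * Real.exp 1 := by nlinarith
  have h4 : (0.48 : ℝ) ≤ Real.log 2 * Real.log 2 := by nlinarith
  by_contra! hcon
  have : (1 : ℝ) < Real.log n * (4 * Real.pi * Real.exp 1 * Real.log 2 * H) := by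
    calc (1 : ℝ) < 34 * 0.48 * (1 / 16) := by norm_num
      _ ≤ (4 * Real.pi * Real.exp 1) * (Real.log 2 * Real.log 2) * H := by gcongr
      _ ≤ (4 * Real.pi * Real.exp 1) * (Real.log n * Real.log 2) * H := by gcongr
      _ = _ := by ring
  linarith

/-! ### The discretisation error -/

/-- A lower bound for the expected maximum of the path that exceeds `L / √H` by the factor `√2`. -/
theorem le_integral_pathMax {Ω : Type*} [MeasurableSpace Ω] {H : ℝ} {B : ℝ≥0 → Ω → ℝ}
    {P : Measure Ω} (hB : IsFractionalBrownianMotion H B P) (hH0 : 0 < H) (hH : H ≤ 1 / 16) :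
    Real.sqrt 2 * (1 / Real.sqrt (4 * Real.pi * Real.exp 1 * Real.log 2) / Real.sqrt H) ≤
      ∫ ω, pathMax B ω ∂P := by
  obtain ⟨N, hN, hpow, hp⟩ := exists_grid_and_level hH0 hH
  set a := Real.sqrt (9 / 10) / Real.sqrt H with ha
  set p := (gaussianReal 0 1).real (Set.Ici a) with hpdef
  -- the probability that `N` independent standard Gaussians are all below `a`
  have hnone : (1 - p) ^ N ≤ 1 / 50 := by
    calc (1 - p) ^ N ≤ Real.exp (-p) ^ N := by
          gcongr
          · linarith [measureReal_le_one (μ := gaussianReal 0 1) (s := Set.Ici a)]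
          · exact Real.one_sub_le_exp_neg p
      _ ≤ Real.exp (-4) := by
          rw [← Real.exp_nat_mul]
          gcongr
          linarith
      _ ≤ 1 / 50 := by
          rw [Real.exp_neg, ← one_div]
          gcongr
          calc (50 : ℝ) ≤ 2.7 ^ 4 := by norm_num
            _ ≤ Real.exp 1 ^ 4 := by gcongr; linarith [Real.exp_one_gt_d9]
            _ = Real.exp 4 := by rw [← Real.exp_nat_mul]; norm_num
  calc Real.sqrt 2 * (1 / Real.sqrt (4 * Real.pi * Real.exp 1 * Real.log 2) / Real.sqrt H)
      = Real.sqrt 2 * (1 / Real.sqrt (4 * Real.pi * Real.exp 1 * Real.log 2)) / Real.sqrt H := by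
        ring
    _ ≤ Real.exp (-(3 / 4)) * (Real.sqrt (9 / 20) * (Real.sqrt (9 / 10) * (49 / 50))) /
          Real.sqrt H :=
        div_le_div_of_nonneg_right sqrt_two_mul_const_le (Real.sqrt_nonneg _)
    _ = Real.exp (-(3 / 4)) * (Real.sqrt (9 / 20) * (a * (49 / 50))) := by rw [ha]; ring
    _ ≤ (N : ℝ) ^ (-H) * (Real.sqrt (9 / 20) * (a * (1 - (1 - p) ^ N))) := by
        gcongr
        linarith
    _ ≤ _ := (le_integral_iSup_grid hB hH0 hH hN a).trans
        (integral_iSup_grid_le_integral_pathMax hB N)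

/-- When the left-hand side is positive, the factor `√2` in the lower bound for the path compensates
for the one in the bound `√(2 log n)` for the grid. -/
theorem le_approxError {Ω : Type*} [MeasurableSpace Ω] {H : ℝ} {B : ℝ≥0 → Ω → ℝ}
    {P : Measure Ω} (hB : IsFractionalBrownianMotion H B P) (hH : 0 < H) {n : ℕ} (hn : 2 ≤ n) :
    max (1 / Real.sqrt (4 * Real.pi * Real.exp 1 * Real.log 2) / Real.sqrt H -
      Real.sqrt (Real.log n)) 0 ≤ approxError B P n := by
  rw [approxError]
  rcases le_or_gt (1 / Real.sqrt (4 * Real.pi * Real.exp 1 * Real.log 2) / Real.sqrt H)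
    (Real.sqrt (Real.log n)) with h | h
  · rw [max_eq_right (sub_nonpos.2 h), sub_nonneg]
    exact integral_mono_ae (integrable_gridMax hB n) (integrable_pathMax hB)
      (gridMax_le_pathMax hB (by omega))
  · rw [max_eq_left (sub_nonneg.2 h.le)]
    have hlow := le_integral_pathMax hB hH (le_one_div_sixteen hH hn h)
    have hup := integral_gridMax_le hB hH hn
    rw [Real.sqrt_mul (by norm_num)] at hup
    have hsqrt2 : 1 ≤ Real.sqrt 2 := Real.one_le_sqrt.2 (by norm_num)
    nlinarith

end FBM

theorem theorem1 {Ω : Type*} [MeasurableSpace Ω] (P : Measure Ω)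
    (H : ℝ) (hH : H ∈ Set.Ioo (0 : ℝ) 1)
    (B : ℝ≥0 → Ω → ℝ) (hB : FBM.IsFractionalBrownianMotion H B P)
    (n : ℕ) (hn : 2 ≤ n) :
    Integrable (FBM.pathMax B) P ∧ Integrable (FBM.gridMax B n) P ∧
      FBM.approxError B P n / ((n : ℝ) ^ (-H) * Real.sqrt (Real.log n)) ≥
        (n : ℝ) ^ H *
          max ((1 / Real.sqrt (4 * Real.pi * Real.exp 1 * Real.log 2)) /
            Real.sqrt (H * Real.log n) - 1) 0 := by
  refine ⟨FBM.integrable_pathMax hB, FBM.integrable_gridMax hB n, ?_⟩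
  have hnpos : (0 : ℝ) < n := by positivity
  have hlog : 0 < Real.log n := Real.log_pos (by exact_mod_cast (by omega : 1 < n))
  have hs : 0 < Real.sqrt (Real.log n) := Real.sqrt_pos.2 hlog
  rw [ge_iff_le, le_div_iff₀ (by positivity)]
  refine le_trans (le_of_eq ?_) (FBM.le_approxError hB hH.1 hn)
  have hcancel : (n : ℝ) ^ H * (n : ℝ) ^ (-H) = 1 := by
    rw [← Real.rpow_add hnpos, add_neg_cancel, Real.rpow_zero]
  set c := 1 / Real.sqrt (4 * Real.pi * Real.exp 1 * Real.log 2)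
  calc (n : ℝ) ^ H * max (c / Real.sqrt (H * Real.log n) - 1) 0 *
        ((n : ℝ) ^ (-H) * Real.sqrt (Real.log n))
      = ((n : ℝ) ^ H * (n : ℝ) ^ (-H)) *
          (max (c / Real.sqrt (H * Real.log n) - 1) 0 * Real.sqrt (Real.log n)) := by ring
    _ = max (c / Real.sqrt H - Real.sqrt (Real.log n)) 0 := by
        rw [hcancel, one_mul, max_mul_of_nonneg _ _ hs.le, zero_mul, Real.sqrt_mul hH.1.le]
        congr 1
        have : 0 < Real.sqrt H := Real.sqrt_pos.2 hH.1
        field_simp
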